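/- Let $X$ be a compact Hausdorff path-connected topological space admitting a universal cover, that is, a simply connected covering space $p\colon\widetilde X\to X$ which, with prescribed base points, factors through every path-connected covering of $X$. (If $X$ is locally path-connected, every simply connected covering has this factorization property.) Let $\mathfrak a\in H^1(X;\mathbb R)$ be a singular cohomology class, let $\mathrm{Homeo}(X,\mathfrak a)$ be the group of homeomorphisms $g$ of $X$ with $g^*\mathfrak a=\mathfrak a$, let $\alpha$ be a singular one-cocycle representing $\mathfrak a$, and let $x\in X$. For $g,h\in\mathrm{Homeo}(X,\mathfrak a)$ put $$\mathfrak G_{x,\alpha}(g,h)=\int_\gamma (g^*\alpha-\alpha),$$ where $\gamma$ is any path from $x$ to $hx$ and $\int_\gamma\sigma$ denotes the value of the cochain $\sigma$ on $\gamma$. This does not depend on $\gamma$, and $\mathfrak G_{x,\alpha}$ is a two-cocycle on the discrete group $\mathrm{Homeo}(X,\mathfrak a)^\delta$ with values in the trivial module $\mathbb R$; let $[\mathfrak G]\in H^2(B\mathrm{Homeo}(X,\mathfrak a)^\delta;\mathbb R)$ be its class. Let $G$ be a group and let $\psi\colon G\to\mathrm{Homeo}(X,\mathfrak a)$ be a homomorphism.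 If there is a Borel probability measure $\mu$ on $X$ with $\psi(g)_*\mu=\mu$ for all $g\in G$, then $$\psi^*[\mathfrak G]=0\quad\text{in } H^2(BG^\delta;\mathbb R).$$ -/

import Mathlib

universe u v

/-! ### Universal covers -/

/-- `p : E → X` is a universal cover: a covering map with simply connected total space which
factors, with prescribed base points, through every path-connected covering of `X`.
(For locally path-connected `X` the last condition follows from the first two.) -/
structure IsUniversalCover {E X : Type u} [TopologicalSpace E] [TopologicalSpace X]
    (p : E → X) : Prop where
  simplyConnected : SimplyConnectedSpace E
  isCoveringMap : IsCoveringMap p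
  exists_factorization : ∀ (Y : Type u) [TopologicalSpace Y] [PathConnectedSpace Y] (q : Y → X),
    IsCoveringMap q → ∀ (e : E) (y : Y), q y = p e → ∃ f : C(E, Y), f e = y ∧ q ∘ f = p

/-- The space `X` admits a universal cover. -/
def AdmitsUniversalCover (X : Type u) [TopologicalSpace X] : Prop :=
  ∃ (E : Type u) (_ : TopologicalSpace E) (p : E → X), IsUniversalCover p

/-! ### Singular cochains and the first singular cohomology group -/

section Singular

variable {X Y Z : Type u} [TopologicalSpace X] [TopologicalSpace Y] [TopologicalSpace Z]

/-- Singular `n`-simplices of `X`. -/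
abbrev SingularSimplex (X : Type u) [TopologicalSpace X] (n : ℕ) : Type u :=
  C(stdSimplex ℝ (Fin (n + 1)), X)

/-- Singular `n`-cochains of `X` with coefficients in `A`: functions on singular `n`-simplices,
which is the same as homomorphisms from the free abelian group on them to `A`. -/
abbrev SingularCochain (X : Type u) [TopologicalSpace X] (A : Type v) (n : ℕ) : Type (max u v) :=
  SingularSimplex X n → A

/-- The `i`-th face of a singular simplex. -/
noncomputable def SingularSimplex.face {n : ℕ} (i : Fin (n + 2)) (σ : SingularSimplex X (n + 1)) :
    SingularSimplex X n :=
  σ.comp ⟨stdSimplex.map i.succAbove, stdSimplex.continuous_map _⟩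

/-- The singular coboundary `(δ c)(σ) = ∑ i, (-1)^i c(dᵢ σ)`. -/
noncomputable def singularCoboundary (X : Type u) [TopologicalSpace X] (A : Type v)
    [AddCommGroup A] (n : ℕ) : SingularCochain X A n →+ SingularCochain X A (n + 1) where
  toFun c σ := ∑ i : Fin (n + 2), (-1 : ℤ) ^ (i : ℕ) • c (σ.face i)
  map_zero' := by ext σ; simp
  map_add' c d := by ext σ; simp [Finset.sum_add_distrib]

/-- The pullback `f^* c = c ∘ f_*` of cochains along a continuous map. -/
def SingularCochain.pullback {A : Type v} [AddCommGroup A] (f : C(X, Y)) (n : ℕ) :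
    SingularCochain Y A n →+ SingularCochain X A n where
  toFun c σ := c (f.comp σ)
  map_zero' := rfl
  map_add' _ _ := rfl

theorem singularCoboundary_pullback {A : Type v} [AddCommGroup A] (f : C(X, Y)) (n : ℕ)
    (c : SingularCochain Y A n) :
    singularCoboundary X A n (SingularCochain.pullback f n c) =
      SingularCochain.pullback f (n + 1) (singularCoboundary Y A n c) := rfl

/-- Singular one-cocycles `Z¹(X; A)`. -/
noncomputable def SingularZ1 (X : Type u) [TopologicalSpace X] (A : Type v) [AddCommGroup A] :
    AddSubgroup (SingularCochain X A 1) :=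
  (singularCoboundary X A 1).ker

/-- Singular one-coboundaries `B¹(X; A)`. -/
noncomputable def SingularB1 (X : Type u) [TopologicalSpace X] (A : Type v) [AddCommGroup A] :
    AddSubgroup (SingularCochain X A 1) :=
  (singularCoboundary X A 0).range

/-- The first singular cohomology group `H¹(X; A) = Z¹(X; A) / B¹(X; A)`. -/
abbrev SingularH1 (X : Type u) [TopologicalSpace X] (A : Type v) [AddCommGroup A] :
    Type (max u v) :=
  SingularZ1 X A ⧸ (SingularB1 X A).addSubgroupOf (SingularZ1 X A)

variable {A : Type v} [AddCommGroup A]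

/-- The pullback of singular one-cocycles along a continuous map. -/
noncomputable def SingularZ1.pullback (f : C(X, Y)) : SingularZ1 Y A →+ SingularZ1 X A :=
  ((SingularCochain.pullback f 1).comp (SingularZ1 Y A).subtype).codRestrict _ (by
    rintro ⟨c, hc⟩
    change singularCoboundary X A 1 (SingularCochain.pullback f 1 c) = 0
    rw [singularCoboundary_pullback, (hc : singularCoboundary Y A 1 c = 0), map_zero])

/-- The cohomology class of a singular one-cocycle. -/
noncomputable def SingularH1.mk : SingularZ1 X A →+ SingularH1 X A :=
  QuotientAddGroup.mk' _

/-- The homomorphism `f^* : H¹(Y; A) → H¹(X; A)` induced by a continuous map. -/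
noncomputable def SingularH1.pullback (f : C(X, Y)) : SingularH1 Y A →+ SingularH1 X A :=
  QuotientAddGroup.map _ _ (SingularZ1.pullback f) (by
    rintro ⟨_, _⟩ ⟨b, rfl⟩
    exact ⟨SingularCochain.pullback f 0 b, rfl⟩)

theorem SingularH1.pullback_mk (f : C(X, Y)) (c : SingularZ1 Y A) :
    SingularH1.pullback f (SingularH1.mk c) = SingularH1.mk (SingularZ1.pullback f c) := rfl

theorem SingularH1.mk_eq_mk_iff (c d : SingularZ1 X A) :
    SingularH1.mk c = SingularH1.mk d ↔
      ∃ b : SingularCochain X A 0, singularCoboundary X A 0 b = (c : SingularCochain X A 1) - d := by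
  rw [eq_comm]
  refine QuotientAddGroup.eq.trans ?_
  rw [AddSubgroup.mem_addSubgroupOf, neg_add_eq_sub]
  rfl

theorem SingularH1.pullback_id (a : SingularH1 X A) :
    SingularH1.pullback (ContinuousMap.id X) a = a := by
  obtain ⟨c, rfl⟩ := QuotientAddGroup.mk'_surjective _ a
  rfl

theorem SingularH1.pullback_comp (g : C(Y, Z)) (f : C(X, Y)) (a : SingularH1 Z A) :
    SingularH1.pullback (g.comp f) a = SingularH1.pullback f (SingularH1.pullback g a) := by
  obtain ⟨c, rfl⟩ := QuotientAddGroup.mk'_surjective _ a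
  rfl

/-- A path regarded as a singular one-simplex, running from vertex `0` to vertex `1`. -/
noncomputable def Path.toSingularSimplex {x y : X} (γ : Path x y) : SingularSimplex X 1 :=
  γ.toContinuousMap.comp
    (stdSimplexHomeomorphUnitInterval : C(stdSimplex ℝ (Fin 2), unitInterval))

/-- The singular zero-simplex at a point. -/
def SingularSimplex.point (x : X) : SingularSimplex X 0 :=
  ContinuousMap.const _ x

theorem singularCoboundary_zero_path (b : SingularCochain X A 0) {x y : X} (γ : Path x y) :
    singularCoboundary X A 0 b γ.toSingularSimplex =
      b (SingularSimplex.point y) - b (SingularSimplex.point x) := by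
  have h0 : SingularSimplex.face 0 γ.toSingularSimplex = SingularSimplex.point y := by
    ext s
    obtain rfl : s = stdSimplex.vertex 0 := Subsingleton.elim _ _
    change γ (stdSimplexHomeomorphUnitInterval (stdSimplex.map _ (stdSimplex.vertex 0))) = y
    rw [stdSimplex.map_vertex]
    exact γ.target
  have h1 : SingularSimplex.face 1 γ.toSingularSimplex = SingularSimplex.point x := by
    ext s
    obtain rfl : s = stdSimplex.vertex 0 := Subsingleton.elim _ _
    change γ (stdSimplexHomeomorphUnitInterval (stdSimplex.map _ (stdSimplex.vertex 0))) = x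
    rw [stdSimplex.map_vertex]
    exact γ.source
  change ∑ i : Fin 2, (-1 : ℤ) ^ (i : ℕ) • b (SingularSimplex.face i γ.toSingularSimplex) = _
  rw [Fin.sum_univ_two, h0, h1]
  simp [sub_eq_add_neg]

end Singular

/-! ### The group `Homeo(X, 𝔞)` and the cocycle `𝔊` -/

section Cocycle

variable {X : Type u} [TopologicalSpace X] {A : Type v} [AddCommGroup A]

/-- The group `Homeo(X, 𝔞)` of homeomorphisms of `X` preserving the class `𝔞 ∈ H¹(X; A)`. -/
noncomputable def HomeoPreserving (a : SingularH1 X A) : Subgroup (X ≃ₜ X) where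
  carrier := {g | SingularH1.pullback (g : C(X, X)) a = a}
  one_mem' := SingularH1.pullback_id a
  mul_mem' {g h} hg hh := by
    change SingularH1.pullback ((g : C(X, X)).comp (h : C(X, X))) a = a
    rw [SingularH1.pullback_comp, hg, hh]
  inv_mem' {g} hg := by
    change SingularH1.pullback ((g⁻¹ : X ≃ₜ X) : C(X, X)) a = a
    have h : (g : C(X, X)).comp ((g⁻¹ : X ≃ₜ X) : C(X, X)) = ContinuousMap.id X := by
      ext y; exact g.apply_symm_apply y
    conv_lhs => rw [← (hg : SingularH1.pullback (g : C(X, X)) a = a)]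
    rw [← SingularH1.pullback_comp, h, SingularH1.pullback_id]

/-- If `g` preserves `[α]` then `g^* α - α` is a coboundary. -/
theorem HomeoPreserving.exists_primitive {a : SingularH1 X A} {α : SingularZ1 X A}
    (hα : SingularH1.mk α = a) (g : HomeoPreserving a) :
    ∃ b : SingularCochain X A 0, singularCoboundary X A 0 b =
      (SingularZ1.pullback (g : C(X, X)) α - α : SingularZ1 X A).1 := by
  subst hα
  exact (SingularH1.mk_eq_mk_iff _ _).1 g.2

variable [PathConnectedSpace X]

/-- `𝔊_{x,α}(g, h) = ∫_γ (g^* α - α)`, where `γ` is a path from `x` to `h x`. The path is chosen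
arbitrarily; `gCocycle_eq` shows that the value does not depend on it. -/
noncomputable def gCocycle (x : X) (α : SingularZ1 X A) (g h : X ≃ₜ X) : A :=
  (SingularZ1.pullback (g : C(X, X)) α - α : SingularZ1 X A).1
    (PathConnectedSpace.somePath x (h x)).toSingularSimplex

/-- `𝔊_{x,α}(g, h)` does not depend on the path from `x` to `h x`. -/
theorem gCocycle_eq (x : X) {a : SingularH1 X A} {α : SingularZ1 X A} (hα : SingularH1.mk α = a)
    (g : HomeoPreserving a) (h : X ≃ₜ X) (γ : Path x (h x)) :
    gCocycle x α g h =
      (SingularZ1.pullback (g : C(X, X)) α - α : SingularZ1 X A).1 γ.toSingularSimplex := by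
  obtain ⟨b, hb⟩ := HomeoPreserving.exists_primitive hα g
  rw [gCocycle, ← hb, singularCoboundary_zero_path, singularCoboundary_zero_path]

/-- `𝔊_{x,α}` is a two-cocycle on `Homeo(X, 𝔞)`. -/
theorem gCocycle_cocycle (x : X) {a : SingularH1 X A} {α : SingularZ1 X A}
    (hα : SingularH1.mk α = a) (g h k : HomeoPreserving a) :
    gCocycle x α h k - gCocycle x α (g * h : X ≃ₜ X) k + gCocycle x α g (h * k : X ≃ₜ X)
      - gCocycle x α g h = 0 := by
  obtain ⟨b, hb⟩ := HomeoPreserving.exists_primitive hα g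
  let γ := PathConnectedSpace.somePath x ((k : X ≃ₜ X) x)
  let γh := PathConnectedSpace.somePath x ((h : X ≃ₜ X) x)
  let γhk : Path ((h : X ≃ₜ X) x) (((h : X ≃ₜ X) * (k : X ≃ₜ X)) x) :=
    γ.map (h : X ≃ₜ X).continuous
  have e1 : (SingularZ1.pullback (g : C(X, X)) α - α : SingularZ1 X A).1 γhk.toSingularSimplex
      = gCocycle x α (g * h : X ≃ₜ X) k - gCocycle x α h k := by
    have : ∀ u v w : A, u - v = (u - w) - (v - w) := fun u v w => by abel
    exact this _ _ _
  have e2 : gCocycle x α g (h * k : X ≃ₜ X) - gCocycle x α g h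
      = (SingularZ1.pullback (g : C(X, X)) α - α : SingularZ1 X A).1 γhk.toSingularSimplex := by
    rw [gCocycle, gCocycle, ← hb, singularCoboundary_zero_path, singularCoboundary_zero_path,
      singularCoboundary_zero_path]
    abel
  rw [add_sub_assoc, e2, e1]
  abel

end Cocycle

/-! ### The class `[𝔊]` in group cohomology -/

section GroupCohomology

/-- The trivial real coefficients of a group in universe `u`, as a representation. `ULift` only
moves `ℝ` to the universe required by `groupCohomology`. -/
noncomputable abbrev realCoeff (G : Type u) [Group G] : Rep (ULift.{u} ℝ) G :=
  Rep.trivial (ULift.{u} ℝ) G (ULift.{u} ℝ)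

/-- `H²(BG^δ; ℝ)`, the second real cohomology of the discrete group `G`. -/
noncomputable abbrev RealH2 (G : Type u) [Group G] : Type u :=
  groupCohomology.H2 (realCoeff G)

/-- The homomorphism `ψ^* : H²(BH^δ; ℝ) → H²(BG^δ; ℝ)` induced by `ψ : G → H`. -/
noncomputable def RealH2.pullback {G H : Type u} [Group G] [Group H] (ψ : G →* H) :
    RealH2 H → RealH2 G :=
  (groupCohomology.map (A := realCoeff H) (B := realCoeff G) ψ
    (CategoryTheory.CategoryStruct.id (realCoeff G)) 2).hom

variable {X : Type u} [TopologicalSpace X] [PathConnectedSpace X]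

/-- The class `[𝔊_{x,α}] ∈ H²(BHomeo(X, 𝔞)^δ; ℝ)`, where `α` is a singular cocycle representing
`𝔞`. -/
noncomputable def gClass (x : X) {a : SingularH1 X ℝ} (α : SingularZ1 X ℝ)
    (hα : SingularH1.mk α = a) : RealH2 (HomeoPreserving a) :=
  groupCohomology.H2π (realCoeff (HomeoPreserving a))
    ⟨fun p => ULift.up (gCocycle x α p.1 p.2), by
      rw [groupCohomology.mem_cocycles₂_def]
      intro g h k
      exact congrArg ULift.up (gCocycle_cocycle x hα g h k)⟩

end GroupCohomology

/-! On the universal cover the pullback of `α` is the increment of a function `f` along paths. A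
singular cochain is arbitrary, so `f` need not be continuous; but compared with its values along a
local section of `p` it is locally constant, and a partition of unity produces `b : X → ℝ` with `f -
b ∘ p` continuous.

Let `B g` be a primitive of `g^* α - α` on `X`. Up to a constant, `B g ∘ p` is `f ∘ G - f` for a
lift `G` of `g`, so `K g = B g - b ∘ g + b` is continuous, with one `b` serving all `g`. The
corrections by `b` cancel in the identity `𝔊(g, h) = K h y - K (g h) y + K g (h y)`, valid for every
`y`. Integrating it against an invariant probability measure exhibits `𝔊` as the coboundary of `g ↦
∫ K g dμ`. -/

section Potential

/-! ### Integration of singular one-cocycles along paths. -/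

open unitInterval

variable {X : Type u} [TopologicalSpace X] {A : Type v} [AddCommGroup A]

/-- The coordinates of the edges of the standard two-simplex. -/
theorem stdSimplex_map_succAbove_apply (s : stdSimplex ℝ (Fin 2)) :
    (stdSimplex.map (Fin.succAbove (0 : Fin 3)) s 1 = s 0 ∧
      stdSimplex.map (Fin.succAbove (0 : Fin 3)) s 2 = s 1) ∧
    (stdSimplex.map (Fin.succAbove (1 : Fin 3)) s 1 = 0 ∧
      stdSimplex.map (Fin.succAbove (1 : Fin 3)) s 2 = s 1) ∧
    (stdSimplex.map (Fin.succAbove (2 : Fin 3)) s 1 = s 1 ∧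
      stdSimplex.map (Fin.succAbove (2 : Fin 3)) s 2 = 0) := by
  simp only [stdSimplex.map_coe, FunOnFinite.linearMap_apply_apply, Finset.sum_filter,
    Fin.sum_univ_two]
  simp [Fin.succAbove, Fin.lt_def, Fin.ext_iff]

/-- A singular one-cocycle is additive along the boundary of a singular two-simplex. -/
theorem SingularZ1.triangle (α : SingularZ1 X A) {x y z : X} (p : Path x y) (q : Path y z)
    (r : Path x z) (τ : SingularSimplex X 2)
    (hp : ∀ v : stdSimplex ℝ (Fin 3), ∀ t : I, v 1 = t → v 2 = 0 → τ v = p t)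
    (hq : ∀ v : stdSimplex ℝ (Fin 3), ∀ t : I, v 1 = σ t → v 2 = t → τ v = q t)
    (hr : ∀ v : stdSimplex ℝ (Fin 3), ∀ t : I, v 1 = 0 → v 2 = t → τ v = r t) :
    α.1 r.toSingularSimplex = α.1 p.toSingularSimplex + α.1 q.toSingularSimplex := by
  have h : singularCoboundary X A 1 α.1 τ = 0 := congrFun α.2 τ
  -- The path parameter on a one-simplex is the coordinate `s 1`; face 0 is the edge from vertex 1
  -- to vertex 2, where `v 1 = 1 - v 2`.
  have e0 : τ.face 0 = q.toSingularSimplex := by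
    ext s
    exact hq _ _ ((stdSimplex_map_succAbove_apply s).1.1.trans
      (eq_sub_of_add_eq (stdSimplex.add_eq_one s))) (stdSimplex_map_succAbove_apply s).1.2
  have e1 : τ.face 1 = r.toSingularSimplex := by
    ext s
    exact hr _ _ (stdSimplex_map_succAbove_apply s).2.1.1 (stdSimplex_map_succAbove_apply s).2.1.2
  have e2 : τ.face 2 = p.toSingularSimplex := by
    ext s
    exact hp _ _ (stdSimplex_map_succAbove_apply s).2.2.1 (stdSimplex_map_succAbove_apply s).2.2.2
  change ∑ i : Fin 3, (-1 : ℤ) ^ (i : ℕ) • α.1 (τ.face i) = 0 at h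
  rw [Fin.sum_univ_three, e0, e1, e2] at h
  simp only [Fin.val_zero, pow_zero, one_smul, Fin.val_one, pow_one, neg_smul, Fin.val_two,
    even_two, Even.neg_pow, one_pow] at h
  rw [← sub_eq_zero, ← neg_eq_zero, ← h]
  abel

theorem SingularZ1.refl (α : SingularZ1 X A) (x : X) :
    α.1 (Path.refl x).toSingularSimplex = 0 := by
  simpa using SingularZ1.triangle α (Path.refl x) (Path.refl x) (Path.refl x) (.const _ x)
    (fun _ _ _ _ => rfl) (fun _ _ _ _ => rfl) (fun _ _ _ _ => rfl)

theorem SingularZ1.trans (α : SingularZ1 X A) {x y z : X} (p : Path x y) (q : Path y z) :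
    α.1 (p.trans q).toSingularSimplex = α.1 p.toSingularSimplex + α.1 q.toSingularSimplex := by
  -- The affine function `v 1 / 2 + v 2` takes the values 0, 1/2, 1 at the vertices, the times at
  -- which `p.trans q` visits `x`, `y`, `z`.
  refine SingularZ1.triangle α p q (p.trans q)
    ⟨fun v => (p.trans q).extend (v 1 / 2 + v 2), ?_⟩ ?_ ?_ ?_
  · have h (i : Fin 3) : Continuous fun v : stdSimplex ℝ (Fin 3) => v i :=
      (continuous_apply i).comp continuous_subtype_val
    exact (p.trans q).continuous_extend.comp (((h 1).div_const 2).add (h 2))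
  · intro v t h1 h2
    have := t.2.1; have := t.2.2
    simp only [ContinuousMap.coe_mk, h1, h2, add_zero]
    rw [Path.extend_apply _ ⟨by linarith, by linarith⟩, Path.trans_apply, dif_pos (by simp; linarith)]
    congr 1; ext; simp; ring
  · intro v t h1 h2
    have := t.2.1; have := t.2.2
    simp only [ContinuousMap.coe_mk, h1, h2, coe_symm_eq]
    rw [Path.extend_apply _ ⟨by linarith, by linarith⟩, Path.trans_apply]
    split_ifs with h
    -- The parameter on this edge is `(1 + t) / 2`, so the first half of the concatenation is met
    -- only at the junction `y`.
    · obtain rfl : t = 0 := Subtype.ext (le_antisymm (show (t : ℝ) ≤ 0 by simp at h; linarith) t.2.1)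
      simp
    · congr 1; ext; simp; ring
  · intro v t h1 h2
    simp [h1, h2]

/-- The diagonal `d` cuts the square of the homotopy into two triangles. Each has one constant side,
on which the cocycle vanishes, so `p` and `q` both have the integral of `d`. -/
theorem SingularZ1.homotopic (α : SingularZ1 X A) {x y : X} {p q : Path x y}
    (h : p.Homotopic q) : α.1 p.toSingularSimplex = α.1 q.toSingularSimplex := by
  obtain ⟨H⟩ := h
  have hc (i : Fin 3) : Continuous fun v : stdSimplex ℝ (Fin 3) => v i :=
    (continuous_apply i).comp continuous_subtype_val
  let d : Path x y :=
    { toFun := fun t => H (t, t)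
      continuous_toFun := by fun_prop
      source' := by simp
      target' := by simp }
  have h1 := SingularZ1.triangle α p (Path.refl y) d
    ⟨fun v => H (Set.projIcc 0 1 zero_le_one (v 2), Set.projIcc 0 1 zero_le_one (v 1 + v 2)),
      H.continuous.comp ((continuous_projIcc.comp (hc 2)).prodMk
        (continuous_projIcc.comp ((hc 1).add (hc 2))))⟩
    (fun v t h1 h2 => by simp [h1, h2]) (fun v t h1 h2 => by simp [h1, h2])
    (fun v t h1 h2 => by simp [h1, h2, d])
  have h2 := SingularZ1.triangle α (Path.refl x) q d
    ⟨fun v => H (Set.projIcc 0 1 zero_le_one (v 1 + v 2), Set.projIcc 0 1 zero_le_one (v 2)),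
      H.continuous.comp ((continuous_projIcc.comp ((hc 1).add (hc 2))).prodMk
        (continuous_projIcc.comp (hc 2)))⟩
    (fun v t h1 h2 => by simp [h1, h2]) (fun v t h1 h2 => by simp [h1, h2])
    (fun v t h1 h2 => by simp [h1, h2, d])
  rw [SingularZ1.refl α, add_zero] at h1
  rw [SingularZ1.refl α, zero_add] at h2
  rw [← h1, h2]

/-- A function `f` is a potential of the one-cochain `c` if `c` integrates along paths to the
increments of `f`. -/
def IsPotential (f : X → A) (c : SingularCochain X A 1) : Prop :=
  ∀ ⦃x y : X⦄ (γ : Path x y), c γ.toSingularSimplex = f y - f x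

/-- A singular one-cocycle on a simply connected space has a potential. -/
theorem SingularZ1.exists_isPotential [SimplyConnectedSpace X] (α : SingularZ1 X A) :
    ∃ f : X → A, IsPotential f α.1 := by
  obtain ⟨x₀⟩ := (inferInstance : Nonempty X)
  refine ⟨fun y => α.1 (PathConnectedSpace.somePath x₀ y).toSingularSimplex, fun x y γ => ?_⟩
  change α.1 _ = α.1 _ - α.1 _
  rw [eq_sub_iff_add_eq', ← SingularZ1.trans α]
  exact SingularZ1.homotopic α (SimplyConnectedSpace.paths_homotopic _ _)

theorem isPotential_of_singularCoboundary {b : SingularCochain X A 0} {c : SingularCochain X A 1}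
    (h : singularCoboundary X A 0 b = c) :
    IsPotential (fun x => b (SingularSimplex.point x)) c :=
  fun _ _ γ => h ▸ singularCoboundary_zero_path b γ

theorem IsPotential.sub {f f' : X → A} {c c' : SingularCochain X A 1} (h : IsPotential f c)
    (h' : IsPotential f' c') : IsPotential (f - f') (c - c') := fun x y γ => by
  simp only [Pi.sub_apply, h γ, h' γ]
  abel

theorem IsPotential.comp {Y : Type u} [TopologicalSpace Y] {f : X → A}
    {c : SingularCochain X A 1} (h : IsPotential f c) (φ : C(Y, X)) :
    IsPotential (f ∘ φ) (SingularCochain.pullback φ 1 c) :=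
  fun _ _ γ => h (γ.map φ.continuous)

/-- Two potentials of the same cochain differ by a constant. -/
theorem IsPotential.sub_eq_sub [PathConnectedSpace X] {f f' : X → A}
    {c : SingularCochain X A 1} (h : IsPotential f c) (h' : IsPotential f' c) (x y : X) :
    f y - f x = f' y - f' x :=
  (h (PathConnectedSpace.somePath x y)).symm.trans (h' _)

end Potential

/-! ### Lifts to the universal cover and continuity of potentials. -/

section Covering

open Topology

variable {E X : Type u} [TopologicalSpace E] [TopologicalSpace X] {p : E → X}

/-- A covering with nonempty total space of a path-connected space is surjective. -/
theorem IsCoveringMap.surjective_of_pathConnectedSpace (hp : IsCoveringMap p) [Nonempty E]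
    [PathConnectedSpace X] : Function.Surjective p := fun x => by
  obtain ⟨e⟩ := ‹Nonempty E›
  let γ := PathConnectedSpace.somePath (p e) x
  refine ⟨hp.liftPath γ e γ.source 1, ?_⟩
  exact (congrFun (hp.liftPath_lifts γ e γ.source) 1).trans γ.target

theorem IsLocalHomeomorph.exists_section (hp : IsLocalHomeomorph p) (e : E) :
    ∃ (U : Set X) (s : X → E), IsOpen U ∧ p e ∈ U ∧ ContinuousOn s U ∧ ∀ y ∈ U, p (s y) = y := by
  obtain ⟨φ, he, rfl⟩ := hp e
  exact ⟨φ.target, φ.symm, φ.open_target, φ.map_source he, φ.continuousOn_symm,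
    fun y hy => φ.right_inv hy⟩

/-- Every homeomorphism of the base lifts to a universal cover. -/
theorem IsUniversalCover.exists_lift (hp : IsUniversalCover p) (g : X ≃ₜ X) (e e' : E)
    (h : p e' = g (p e)) : ∃ f : C(E, E), f e = e' ∧ ∀ z, p (f z) = g (p z) := by
  have := hp.simplyConnected
  -- Without local path-connectedness the usual lifting criterion does not apply; instead `p` is
  -- factored through the covering `g⁻¹ ∘ p`.
  obtain ⟨f, hf, hf'⟩ := hp.exists_factorization E (g.symm ∘ p)
    (hp.isCoveringMap.homeomorph_comp g.symm) e e' (by simp [h])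
  refine ⟨f, hf, fun z => ?_⟩
  rw [← congrFun hf' z]
  simp

variable {A : Type v} [AddCommGroup A]

/-- Potentials on a universal cover of a cochain pulled back from the base, compared along a local
section, change by locally constant amounts. -/
theorem IsUniversalCover.eventually_sub_section_eq (hp : IsUniversalCover p) {f : E → A}
    {c : SingularCochain X A 1}
    (hf : IsPotential f (SingularCochain.pullback ⟨p, hp.isCoveringMap.continuous⟩ 1 c))
    {U : Set X} (hU : IsOpen U) {s : X → E} (hs : ContinuousOn s U) (hps : ∀ y ∈ U, p (s y) = y)
    (e : E) (he : p e ∈ U) :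
    ∀ᶠ z in 𝓝 e, f z - f (s (p z)) = f e - f (s (p e)) := by
  have := hp.simplyConnected
  have hpc := hp.isCoveringMap.continuous
  -- `D` covers the identity and agrees with `s ∘ p` near `e`, because `p` is injective near `s (p
  -- e)`. As `f` and `f ∘ D` are potentials of the same cochain, they differ by a constant.
  obtain ⟨D, hDe, hD⟩ := hp.exists_lift (Homeomorph.refl X) e (s (p e)) (hps _ he)
  have hDp : (⟨p, hpc⟩ : C(E, X)).comp D = ⟨p, hpc⟩ := ContinuousMap.ext hD
  have hfD : IsPotential (f ∘ D) (SingularCochain.pullback ⟨p, hpc⟩ 1 c) := by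
    intro x y γ
    rw [← hf.comp D γ]
    change _ = c (((⟨p, hpc⟩ : C(E, X)).comp D).comp γ.toSingularSimplex)
    rw [hDp]
    rfl
  have hsp : ContinuousAt (s ∘ p) e :=
    (hs.continuousAt (hU.mem_nhds he)).comp hpc.continuousAt
  obtain ⟨φ, hφ, hφp⟩ := hp.isCoveringMap.isLocalHomeomorph (s (p e))
  have h1 : ∀ᶠ z in 𝓝 e, D z ∈ φ.source :=
    D.continuous.continuousAt.eventually_mem (hDe ▸ φ.open_source.mem_nhds hφ)
  have h2 : ∀ᶠ z in 𝓝 e, s (p z) ∈ φ.source :=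
    hsp.eventually_mem (φ.open_source.mem_nhds hφ)
  filter_upwards [h1, h2, hpc.continuousAt.eventually_mem (hU.mem_nhds he)] with z hz1 hz2 hz3
  have hDz : D z = s (p z) := φ.injOn hz1 hz2 (by rw [← hφp, hD, hps _ hz3]; rfl)
  have := hf.sub_eq_sub hfD e z
  simp only [Function.comp_apply, hDe, hDz] at this
  rw [sub_eq_sub_iff_sub_eq_sub, this]

/-- Over a compact Hausdorff base, a potential on a universal cover of a real cochain pulled back
from the base becomes continuous after subtracting a function pulled back from the base. -/
theorem IsUniversalCover.exists_continuous_sub [CompactSpace X] [T2Space X] [PathConnectedSpace X]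
    (hp : IsUniversalCover p) {f : E → ℝ} {c : SingularCochain X ℝ 1}
    (hf : IsPotential f (SingularCochain.pullback ⟨p, hp.isCoveringMap.continuous⟩ 1 c)) :
    ∃ b : X → ℝ, Continuous fun e => f e - b (p e) := by
  have := hp.simplyConnected
  have hpc := hp.isCoveringMap.continuous
  choose r hr using hp.isCoveringMap.surjective_of_pathConnectedSpace
  have hloc (x : X) := hp.isCoveringMap.isLocalHomeomorph.exists_section (r x)
  simp only [hr] at hloc
  choose U s hU hxU hs hps using hloc
  obtain ⟨t, ht⟩ := isCompact_univ.elim_finite_subcover U hU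
    fun x _ => Set.mem_iUnion.2 ⟨x, hxU x⟩
  obtain ⟨ρ, hρ⟩ := PartitionOfUnity.exists_isSubordinate isClosed_univ (fun i : t => U i)
    (fun i => hU i) (by simpa [Set.iUnion_subtype] using ht)
  have hsum (x : X) : ∑ i, ρ i x = 1 := by
    rw [← finsum_eq_sum_of_fintype, ρ.sum_eq_one (Set.mem_univ x)]
  -- The weighted average of `f` over the local sections: since the weights sum to 1, the difference
  -- is a sum of terms `ρ i * (f - f ∘ s i ∘ p)`, locally constant up to the weight.
  refine ⟨fun x => ∑ i : t, ρ i x * f (s i x), ?_⟩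
  have key : (fun e => f e - ∑ i : t, ρ i (p e) * f (s i (p e))) =
      fun e => ∑ i : t, ρ i (p e) * (f e - f (s i (p e))) := by
    ext e
    simp only [mul_sub, Finset.sum_sub_distrib, ← Finset.sum_mul, hsum, one_mul]
  rw [key]
  refine continuous_finsetSum _ fun i _ => continuous_iff_continuousAt.2 fun e => ?_
  by_cases he : p e ∈ U i
  · refine ((ρ i).continuous.comp hpc).continuousAt.mul ?_
    exact (Filter.EventuallyEq.continuousAt
      (hp.eventually_sub_section_eq hf (hU i) (hs i) (hps i) e he))
  -- Outside `U i` the section is uncontrolled, but there the weight vanishes on a neighbourhood.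
  · have h0 : ∀ᶠ z in 𝓝 e, ρ i (p z) * (f z - f (s i (p z))) = 0 := by
      have : ∀ᶠ z in 𝓝 e, p z ∈ (tsupport (ρ i))ᶜ :=
        hpc.continuousAt.eventually_mem
          ((isClosed_tsupport _).isOpen_compl.mem_nhds fun h => he (hρ i h))
      filter_upwards [this] with z hz
      rw [image_eq_zero_of_notMem_tsupport hz, zero_mul]
    exact Filter.EventuallyEq.continuousAt h0

end Covering

/-! ### Continuous primitives and averaging over the invariant measure. -/

section Main

variable {X : Type u} [TopologicalSpace X] [PathConnectedSpace X]

/-- Integrating `g^* α - α` from the base point gives a potential. -/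
theorem isPotential_integral (x : X) {A : Type v} [AddCommGroup A] {a : SingularH1 X A}
    {α : SingularZ1 X A} (hα : SingularH1.mk α = a) (g : HomeoPreserving a) :
    IsPotential (fun y => (SingularZ1.pullback (g : C(X, X)) α - α : SingularZ1 X A).1
      (PathConnectedSpace.somePath x y).toSingularSimplex)
      (SingularZ1.pullback (g : C(X, X)) α - α : SingularZ1 X A).1 := by
  obtain ⟨b, hb⟩ := HomeoPreserving.exists_primitive hα g
  intro y z γ
  have h := isPotential_of_singularCoboundary hb
  simp only [h γ, h (PathConnectedSpace.somePath x _)]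
  abel

/-- The potentials of `g^* α - α` can be corrected by a coboundary, the same for all `g`, to
become continuous. -/
theorem HomeoPreserving.exists_continuous_potential [CompactSpace X] [T2Space X]
    (hX : AdmitsUniversalCover X) {a : SingularH1 X ℝ} {α : SingularZ1 X ℝ} :
    ∃ b : X → ℝ, ∀ (g : HomeoPreserving a) (B : X → ℝ),
      IsPotential B (SingularZ1.pullback (g : C(X, X)) α - α : SingularZ1 X ℝ).1 →
        Continuous fun y => B y - b ((g : X ≃ₜ X) y) + b y := by
  obtain ⟨E, _, p, hp⟩ := hX
  have := hp.simplyConnected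
  have hpc := hp.isCoveringMap.continuous
  have hps := hp.isCoveringMap.surjective_of_pathConnectedSpace
  obtain ⟨f, hf⟩ := SingularZ1.exists_isPotential (SingularZ1.pullback ⟨p, hpc⟩ α)
  obtain ⟨b, hb⟩ := hp.exists_continuous_sub hf
  refine ⟨b, fun g B hB => ?_⟩
  -- Since `p` is a quotient map, continuity may be tested on `E`, where `f` is available.
  rw [(hp.isCoveringMap.isQuotientMap hps).continuous_iff]
  obtain ⟨e⟩ := (inferInstance : Nonempty E)
  obtain ⟨e', he'⟩ := hps ((g : X ≃ₜ X) (p e))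
  obtain ⟨G, -, hG⟩ := hp.exists_lift (g : X ≃ₜ X) e e' he'
  have h2 : (⟨p, hpc⟩ : C(E, X)).comp G = ((g : X ≃ₜ X) : C(X, X)).comp ⟨p, hpc⟩ :=
    ContinuousMap.ext hG
  have h1 : IsPotential (f ∘ G - f) (SingularCochain.pullback ⟨p, hpc⟩ 1
      (SingularZ1.pullback (g : C(X, X)) α - α : SingularZ1 X ℝ).1) := by
    intro y z γ
    rw [← (hf.comp G).sub hf γ]
    change α.1 ((((g : X ≃ₜ X) : C(X, X)).comp ⟨p, hpc⟩).comp γ.toSingularSimplex) - _ =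
      α.1 (((⟨p, hpc⟩ : C(E, X)).comp G).comp γ.toSingularSimplex) - _
    rw [h2]
    rfl
  have h3 (z : E) := (hB.comp ⟨p, hpc⟩).sub_eq_sub h1 e z
  -- `B ∘ p` and `f ∘ G - f` differ by a constant, so the function becomes `F ∘ G - F` plus a
  -- constant, with `F = f - b ∘ p` continuous.
  have h4 : (fun y => B y - b ((g : X ≃ₜ X) y) + b y) ∘ p = fun z =>
      (f (G z) - b (p (G z))) - (f z - b (p z)) + (B (p e) - (f (G e) - f e)) := by
    ext z
    have := h3 z
    simp only [Function.comp_apply, ContinuousMap.coe_mk, Pi.sub_apply] at this ⊢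
    rw [hG]
    linarith
  rw [h4]
  exact ((hb.comp G.continuous).sub hb).add continuous_const

/-- The pullback of `[𝔊]` vanishes as soon as `𝔊` is the coboundary of a function on `G`. -/
theorem RealH2.pullback_gClass_eq_zero (x : X) {a : SingularH1 X ℝ} {α : SingularZ1 X ℝ}
    (hα : SingularH1.mk α = a) {G : Type u} [Group G] (ψ : G →* HomeoPreserving a) (k : G → ℝ)
    (hk : ∀ g h, gCocycle x α (ψ g : X ≃ₜ X) (ψ h : X ≃ₜ X) = k h - k (g * h) + k g) :
    RealH2.pullback ψ (gClass x α hα) = 0 := by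
  have h := groupCohomology.H2π_comp_map_apply (A := realCoeff (HomeoPreserving a))
    (B := realCoeff G) ψ (CategoryTheory.CategoryStruct.id (realCoeff G))
  refine (h _).trans ((groupCohomology.H2π_eq_zero_iff _).2 ⟨fun g => ULift.up (k g), ?_⟩)
  ext ⟨g, h⟩
  exact (hk g h).symm

end Main

theorem mainTheorem6 {X : Type u} [TopologicalSpace X] [CompactSpace X] [T2Space X]
    [PathConnectedSpace X] (hX : AdmitsUniversalCover X)
    [MeasurableSpace X] [BorelSpace X]
    (a : SingularH1 X ℝ) (α : SingularZ1 X ℝ) (hα : SingularH1.mk α = a) (x : X)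
    {G : Type u} [Group G] (ψ : G →* HomeoPreserving a)
    (μ : MeasureTheory.Measure X) [MeasureTheory.IsProbabilityMeasure μ]
    (hμ : ∀ g : G, MeasureTheory.MeasurePreserving (ψ g : X ≃ₜ X) μ μ) :
    RealH2.pullback ψ (gClass x α hα) = 0 := by
  obtain ⟨b, hb⟩ := HomeoPreserving.exists_continuous_potential hX (a := a) (α := α)
  let B (g : HomeoPreserving a) (y : X) : ℝ :=
    (SingularZ1.pullback (g : C(X, X)) α - α : SingularZ1 X ℝ).1
      (PathConnectedSpace.somePath x y).toSingularSimplex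
  have hB (g : HomeoPreserving a) : IsPotential (B g) _ := isPotential_integral x hα g
  let K (g : HomeoPreserving a) (y : X) : ℝ := B g y - b ((g : X ≃ₜ X) y) + b y
  have hK (g : HomeoPreserving a) : Continuous (K g) := hb g (B g) (hB g)
  have hKi (g : HomeoPreserving a) : MeasureTheory.Integrable (K g) μ :=
    (hK g).integrable_of_hasCompactSupport (HasCompactSupport.of_compactSpace _)
  -- This integrates `(gh)^* α - α = h^* (g^* α - α) + (h^* α - α)` from `x` to `y`.
  have hBmul (g h : HomeoPreserving a) (y : X) :
      B (g * h) y = B g ((h : X ≃ₜ X) y) - B g ((h : X ≃ₜ X) x) + B h y := by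
    let γ := PathConnectedSpace.somePath x y
    rw [← hB g (γ.map (h : X ≃ₜ X).continuous)]
    exact (sub_add_sub_cancel _ _ _).symm
  have hKmul (g h : HomeoPreserving a) (y : X) :
      gCocycle x α g h = K h y - K (g * h) y + K g ((h : X ≃ₜ X) y) := by
    change B g ((h : X ≃ₜ X) x) = B h y - b ((h : X ≃ₜ X) y) + b y -
      (B (g * h) y - b ((g : X ≃ₜ X) ((h : X ≃ₜ X) y)) + b y) +
      (B g ((h : X ≃ₜ X) y) - b ((g : X ≃ₜ X) ((h : X ≃ₜ X) y)) + b ((h : X ≃ₜ X) y))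
    rw [hBmul]
    ring
  refine RealH2.pullback_gClass_eq_zero x hα ψ (fun g => ∫ y, K (ψ g) y ∂μ) fun g h => ?_
  -- Invariance of `μ` removes the shift by `h`, the only obstacle to `K` integrating to a
  -- coboundary.
  have hinv : ∫ y, K (ψ g) ((ψ h : X ≃ₜ X) y) ∂μ = ∫ y, K (ψ g) y ∂μ :=
    (hμ h).integral_comp (ψ h : X ≃ₜ X).measurableEmbedding _
  have hint : MeasureTheory.Integrable (fun y => K (ψ g) ((ψ h : X ≃ₜ X) y)) μ :=
    (hμ h).integrable_comp_of_integrable (hKi (ψ g))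
  have hsub : MeasureTheory.Integrable (fun y => K (ψ h) y - K (ψ g * ψ h) y) μ :=
    (hKi _).sub (hKi _)
  rw [map_mul, ← hinv, ← MeasureTheory.integral_sub (hKi _) (hKi _),
    ← MeasureTheory.integral_add hsub hint]
  -- The combined integrand is the constant `𝔊(g, h)`, which equals its integral because `μ` has
  -- total mass 1.
  simp_rw [← hKmul]
  simp
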